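/- Let $\{\epsilon_t\}_{t\in\mathbb Z}$ be Gaussian white noise with unit variance, and let market demand be $D_t=\mu+\sum_{k\ge 0}\psi_k\,\epsilon_{t-k}$ (convergence in $L^2$) with real $\psi=(\psi_k)\in\ell^2$ and $\psi(z)=\sum_k\psi_k z^k$; assume that $\{D_t\}$ is invertible with respect to $\{\epsilon_t\}$, i.e. each $\epsilon_t$ is an $L^2$-limit of finite linear combinations of $D_{t-k}-\mu$, $k\ge 0$. Let $N\ge 3$ be an odd number of sellers. A demand allocation policy gives each seller $n\in\{1,\dots,N\}$ a mean $\mu_n$ and a transfer function $\tau_n(z)=\sum_{k\ge0}\tau_{nk}z^k$ with $(\tau_{nk})_k\in\ell^2$; seller $n$ then receives the demand $D_{nt}=\mu_n+\sum_{k\ge 0}\tau_{nk}(D_{t-k}-\mu)$. It is admissible if $\sum_n\mu_n=\mu$ and $\sum_n\tau_n(z)=1$. Let $\mathcal F_{nt}$ be the $\sigma$-algebra generated by $\{D_{ns}\}_{s\le t}$ and $m_{nt}=\mathbb E[D_{n,t+1}\mid\mathcal F_{nt}]$. Seller $n$ has root MSFE (root mean squared forecast error) $\sigma_n\ge0$ if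 $\operatorname{Var}[D_{n,t+1}-m_{nt}\mid\mathcal F_{nt}]=\sigma_n^2$ almost surely for every $t$. An admissible policy is neutral if $\mu_n=\mu/N$ for all $n$ and all sellers have the same root MSFE, and this common value is positive. Let $\sigma_{\rm L}=|\psi(0)|/N$, let $\sigma>\sigma_{\rm L}$, and put $\bar\alpha=\sigma/\sigma_{\rm L}=N\sigma/|\psi(0)|$, $$\mathcal T_1(z)=1+\bar\alpha z+\bar\alpha z^2,\qquad \mathcal T_2(z)=1-\bar\alpha z^2,\qquad \mathcal T_n(z)=1+(-1)^n\bar\alpha z\quad(3\le n\le N).$$ Then the policy with $\mu_n=\mu/N$ and $\tau_n(z)=\frac1N\mathcal T_n(z)$, under which $D_{nt}=\frac{\mu}{N}+\sum_{k\ge0}\psi_{nk}\epsilon_{t-k}$ with $\sum_k\psi_{nk}z^k=\psi_n(z)=\frac1N\psi(z)\mathcal T_n(z)$, is admissible and neutral, and every seller has root MSFE $\sigma$. -/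

import Mathlib

open MeasureTheory ProbabilityTheory Filter Topology
open scoped ENNReal

noncomputable section

namespace DemandAllocation

variable {Ω : Type*} [MeasurableSpace Ω]

/-- The process `X` is the output of the causal filter `f` applied to the process `Y`, that is,
`X t = ∑ₖ fₖ Y (t - k)` for all `t ∈ ℤ`, the series converging in `L²(P)`.
In backshift notation, `X = f(B) Y`. -/
def IsFilterOutput (P : Measure Ω) (f : PowerSeries ℝ) (Y X : ℤ → Ω → ℝ) : Prop :=
  ∀ t : ℤ, Tendsto
    (fun K : ℕ => eLpNorm
      (fun ω => X t ω - ∑ k ∈ Finset.range K, PowerSeries.coeff k f * Y (t - k) ω) 2 P)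
    atTop (𝓝 0)

/-- The coefficient sequence of `f` lies in `ℓ²` (equivalently, `f` lies in the Hardy space `H²`). -/
def IsSquareSummable (f : PowerSeries ℝ) : Prop :=
  Summable fun k : ℕ => (PowerSeries.coeff k f) ^ 2

/-- Gaussian white noise with unit variance, indexed by `ℤ`. -/
structure IsGaussianWhiteNoise (P : Measure Ω) (ε : ℤ → Ω → ℝ) : Prop where
  measurable : ∀ t, Measurable (ε t)
  gaussian : IsGaussianProcess ε P
  mean_eq_zero : ∀ t, P[ε t] = 0
  covariance_eq : ∀ s t, cov[ε s, ε t; P] = if s = t then 1 else 0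

/-- The process `Y`, centred at `m`, is invertible with respect to the shocks `ε`: every shock `ε t`
can be recovered linearly from the history of `Y`, i.e. it is an `L²(P)`-limit of finite linear
combinations of the centred values `Y (t - k) - m`, `k ≥ 0`.
(An expansion `ε t = ∑ₖ wₖ (Y (t - k) - m)` converging in `L²(P)` is a special case.) -/
def IsInvertible (P : Measure Ω) (m : ℝ) (ε Y : ℤ → Ω → ℝ) : Prop :=
  ∀ t : ℤ, ∀ δ : ℝ≥0∞, 0 < δ → ∃ (K : ℕ) (c : ℕ → ℝ),
    eLpNorm (fun ω => ε t ω - ∑ k ∈ Finset.range K, c k * (Y (t - k) ω - m)) 2 P < δ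

/-- Market demand `D t = m + ∑ₖ ψₖ ε (t - k)` with mean `m`, square-summable `ψ` and Gaussian white
noise shocks `ε` of unit variance, invertible with respect to `ε`. -/
structure IsMarketDemand (P : Measure Ω) (m : ℝ) (ψ : PowerSeries ℝ) (ε D : ℤ → Ω → ℝ) : Prop where
  measurable : ∀ t, Measurable (D t)
  whiteNoise : IsGaussianWhiteNoise P ε
  squareSummable : IsSquareSummable ψ
  representation : IsFilterOutput P ψ ε (fun t ω => D t ω - m)
  invertible : IsInvertible P m ε D

/-- The data of a demand allocation policy for `N` sellers: a mean and a transfer function for each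
seller. Seller `n ∈ {1, …, N}` is represented by the index `n - 1 : Fin N`. -/
structure Policy (N : ℕ) where
  mean : Fin N → ℝ
  transfer : Fin N → PowerSeries ℝ

/-- A policy is admissible for a market demand of mean `m` if its transfer functions have
square-summable coefficients, the means add up to `m`, and the transfer functions add up to `1`. -/
structure Policy.IsAdmissible {N : ℕ} (π : Policy N) (m : ℝ) : Prop where
  squareSummable : ∀ n, IsSquareSummable (π.transfer n)
  sum_mean : ∑ n, π.mean n = m
  sum_transfer : ∑ n, π.transfer n = 1

/-- `X` is (a version of) the demand process of seller `n` under the policy `π`: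
`X t = μₙ + ∑ₖ τₙₖ (D (t - k) - m)`. -/
structure Policy.IsSellerDemand {N : ℕ} (π : Policy N) (P : Measure Ω) (m : ℝ) (D : ℤ → Ω → ℝ)
    (n : Fin N) (X : ℤ → Ω → ℝ) : Prop where
  measurable : ∀ t, Measurable (X t)
  filter : IsFilterOutput P (π.transfer n) (fun t ω => D t ω - m) (fun t ω => X t ω - π.mean n)

/-- The information available at time `t` to an observer of `X`: the σ-algebra generated by
`X s`, `s ≤ t`. -/
abbrev history (X : ℤ → Ω → ℝ) (t : ℤ) : MeasurableSpace Ω :=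
  ⨆ s : Set.Iic t, MeasurableSpace.comap (X s) inferInstance

/-- The one-step-ahead mean forecast `E[X (t + 1) | X s, s ≤ t]`. -/
def forecast (P : Measure Ω) (X : ℤ → Ω → ℝ) (t : ℤ) : Ω → ℝ :=
  P[X (t + 1) | history X t]

/-- The square-integrable process `X` has one-step-ahead root mean squared forecast error `s ≥ 0`:
at every time `t` the conditional variance of the forecast error given the history of `X` is almost surely `s²`. -/
def HasRootMSFE (P : Measure Ω) (X : ℤ → Ω → ℝ) (s : ℝ) : Prop :=
  0 ≤ s ∧ (∀ t : ℤ, MemLp (X t) 2 P) ∧ ∀ t : ℤ, condVar (history X t) (fun ω => X (t + 1) ω - forecast P X t ω) P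
    =ᵐ[P] fun _ => s ^ 2

/-- Under `π`, seller `n` has a well-defined demand process, and its root MSFE is `s`. -/
def Policy.SellerHasRootMSFE {N : ℕ} (π : Policy N) (P : Measure Ω) (m : ℝ) (D : ℤ → Ω → ℝ)
    (n : Fin N) (s : ℝ) : Prop :=
  (∃ X, π.IsSellerDemand P m D n X) ∧ ∀ X, π.IsSellerDemand P m D n X → HasRootMSFE P X s

/-- A neutral policy: all sellers have mean demand `m / N` and one common positive root MSFE. -/
def Policy.IsNeutral {N : ℕ} (π : Policy N) (P : Measure Ω) (m : ℝ) (D : ℤ → Ω → ℝ) : Prop :=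
  ∃ s : ℝ, 0 < s ∧ ∀ n, π.mean n = m / N ∧ π.SellerHasRootMSFE P m D n s

/-- The lower bound `|ψ₀| / N`, the root MSFE under the uniform split. -/
def sigmaL (N : ℕ) (ψ : PowerSeries ℝ) : ℝ := |PowerSeries.constantCoeff ψ| / N

/-- The transfer functions relative to the uniform split, for sellers `n = 1, 2, 3, …`:
`T₁ = 1 + a z + a z²`, `T₂ = 1 - a z²` and `Tₙ = 1 + (-1)ⁿ a z` for `n ≥ 3`.
(The value at `n = 0` is irrelevant.) -/
def oddTransfer (a : ℝ) (n : ℕ) : PowerSeries ℝ :=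
  if n = 1 then 1 + PowerSeries.C a * PowerSeries.X + PowerSeries.C a * PowerSeries.X ^ 2
  else if n = 2 then 1 - PowerSeries.C a * PowerSeries.X ^ 2
  else 1 + PowerSeries.C ((-1) ^ n * a) * PowerSeries.X

/-- The policy with equal means `m / N` under which seller `n` has transfer function `Tₙ / N`. -/
def oddPolicy (N : ℕ) (m a : ℝ) : Policy N where
  mean _ := m / N
  transfer i := PowerSeries.C (1 / (N : ℝ)) * oddTransfer a (i + 1)

end DemandAllocation

end

open DemandAllocation

/-!
The claim is a statement about one-step linear prediction in `L²(P)`. Write `y = D - m`. The transfer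
function `T` of a seller is a polynomial of degree at most two, whose roots all lie strictly inside
the unit disc because `α > 1`; its reversal `r` has all roots outside the closed disc, constant
coefficient `± α`, and the same modulus as `T` on the unit circle, that is, the same autocorrelation
of coefficients.

Since `y` is stationary, the sequences `T(B) y` and `r(B) y` have the same Gram matrix
(`IsStationary.inner_quadFilter_eq`). The distance from the next value to the closed span of the past
depends on the Gram matrix only (`IsInnovation.norm_le_of_inner_eq`), so it may be computed for
`r(B) y` instead. There the pasts of `r(B) y`, of `y` and of the shocks coincide: the filter `r` can
be undone because the recurrence with coefficients `r` has no nonzero bounded solution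
(`IsMinimumPhase.mem_linearPast`), and `y` is invertible. Hence the prediction error is the
contribution `r 0 ψ₀ ε (t + 1)` of the newest shock
(`IsMovingAverage.isInnovation_of_isMinimumPhase`), and dividing by `N` gives the norm
`α |ψ₀| / N = σ`. Invertibility also yields `ψ₀ ≠ 0`, so `α` is a genuine quotient and `α > 1`.

Linear prediction is conditional expectation here. Every element of the closed span of the shocks is
Gaussian (`map_eq_gaussianReal`), so the linear innovation, being uncorrelated with the history, is
independent of it; the conditional variance is therefore the constant `σ²`
(`hasRootMSFE_of_isInnovation`).
-/

noncomputable section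

namespace DemandAllocation

open scoped InnerProductSpace

variable {Ω : Type*} [MeasurableSpace Ω]

/-! ### Linear prediction in a Hilbert space -/

section Hilbert

variable {H : Type*} [NormedAddCommGroup H] [InnerProductSpace ℝ H]

/-- The linear past of `x` at time `t`: the closed linear span of `x s`, `s ≤ t`. -/
def linearPast (x : ℤ → H) (t : ℤ) : Submodule ℝ H :=
  (Submodule.span ℝ (x '' Set.Iic t)).topologicalClosure

lemma isClosed_linearPast (x : ℤ → H) (t : ℤ) : IsClosed (linearPast x t : Set H) :=
  Submodule.isClosed_topologicalClosure _

lemma mem_linearPast (x : ℤ → H) {s t : ℤ} (h : s ≤ t) : x s ∈ linearPast x t :=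
  Submodule.le_topologicalClosure _ (Submodule.subset_span ⟨s, h, rfl⟩)

lemma linearPast_le {x : ℤ → H} {t : ℤ} {K : Submodule ℝ H} (hK : IsClosed (K : Set H))
    (h : ∀ s ≤ t, x s ∈ K) : linearPast x t ≤ K := by
  refine Submodule.topologicalClosure_minimal _ (Submodule.span_le.2 ?_) hK
  rintro _ ⟨s, hs, rfl⟩
  exact h s hs

lemma linearPast_mono (x : ℤ → H) {s t : ℤ} (h : s ≤ t) : linearPast x s ≤ linearPast x t :=
  linearPast_le (isClosed_linearPast x t) fun _ hr => mem_linearPast x (hr.trans h)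

/-- Application of the backshift polynomial `c 0 + c 1 B + c 2 B²` to the sequence `y`. -/
def quadFilter (c : Fin 3 → ℝ) (y : ℤ → H) (t : ℤ) : H :=
  c 0 • y t + c 1 • y (t - 1) + c 2 • y (t - 2)

lemma quadFilter_mem {c : Fin 3 → ℝ} {y : ℤ → H} {t : ℤ} {K : Submodule ℝ H}
    (h : ∀ s ≤ t, y s ∈ K) : quadFilter c y t ∈ K :=
  K.add_mem (K.add_mem (K.smul_mem _ (h _ le_rfl)) (K.smul_mem _ (h _ (by omega))))
    (K.smul_mem _ (h _ (by omega)))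

/-- `e` is the innovation of `x` at time `t + 1`: the part of `x (t + 1)` that is orthogonal to the
linear past of `x` at time `t`. -/
structure IsInnovation (x : ℤ → H) (t : ℤ) (e : H) : Prop where
  orthogonal : e ∈ (linearPast x t)ᗮ
  sub_mem : x (t + 1) - e ∈ linearPast x t

lemma IsInnovation.norm_le {x : ℤ → H} {t : ℤ} {e : H} (he : IsInnovation x t e) {v : H}
    (hv : v ∈ linearPast x t) : ‖e‖ ≤ ‖x (t + 1) - v‖ := by
  have h0 : ⟪e, x (t + 1) - e - v⟫_ℝ = 0 :=
    Submodule.inner_left_of_mem_orthogonal (Submodule.sub_mem _ he.sub_mem hv) he.orthogonal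
  have h1 := norm_add_sq_eq_norm_sq_add_norm_sq_of_inner_eq_zero e (x (t + 1) - e - v) h0
  have h2 : e + (x (t + 1) - e - v) = x (t + 1) - v := by abel
  rw [h2] at h1
  nlinarith [norm_nonneg e, norm_nonneg (x (t + 1) - v), norm_nonneg (x (t + 1) - e - v)]

lemma exists_isInnovation [CompleteSpace H] (x : ℤ → H) (t : ℤ) : ∃ e, IsInnovation x t e := by
  have : CompleteSpace (linearPast x t) := (isClosed_linearPast x t).completeSpace_coe
  obtain ⟨v, hv, e, he, h⟩ := (linearPast x t).exists_add_mem_mem_orthogonal (x (t + 1))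
  exact ⟨e, he, by rw [h, add_sub_cancel_right]; exact hv⟩

lemma norm_linearCombination_eq {ι : Type*} {x w : ι → H}
    (h : ∀ s r, ⟪x s, x r⟫_ℝ = ⟪w s, w r⟫_ℝ) (l : ι →₀ ℝ) :
    ‖Finsupp.linearCombination ℝ x l‖ = ‖Finsupp.linearCombination ℝ w l‖ := by
  have : ‖Finsupp.linearCombination ℝ x l‖ ^ 2 = ‖Finsupp.linearCombination ℝ w l‖ ^ 2 := by
    simp only [← real_inner_self_eq_norm_sq, Finsupp.linearCombination_apply, Finsupp.sum_inner,
      Finsupp.inner_sum, real_inner_smul_left, real_inner_smul_right, h]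
  exact (sq_eq_sq₀ (norm_nonneg _) (norm_nonneg _)).1 this

/-- The size of the innovation is a function of the Gram matrix: it is the distance from
`x (t + 1)` to the finite linear combinations of the `x s`, `s ≤ t`. -/
lemma IsInnovation.norm_le_of_inner_eq {x w : ℤ → H} {t : ℤ} {e f : H} (he : IsInnovation x t e)
    (hf : IsInnovation w t f) (h : ∀ s r, ⟪x s, x r⟫_ℝ = ⟪w s, w r⟫_ℝ) : ‖e‖ ≤ ‖f‖ := by
  refine le_of_forall_pos_le_add fun δ hδ => ?_
  have hmem : w (t + 1) - f ∈ closure (Submodule.span ℝ (w '' Set.Iic t) : Set H) := hf.sub_mem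
  obtain ⟨v, hv, hd⟩ := Metric.mem_closure_iff.1 hmem δ hδ
  obtain ⟨l, hl, rfl⟩ := (Finsupp.mem_span_image_iff_linearCombination ℝ).1 hv
  have hx : Finsupp.linearCombination ℝ x l ∈ linearPast x t :=
    Submodule.le_topologicalClosure _
      ((Finsupp.mem_span_image_iff_linearCombination ℝ).2 ⟨l, hl, rfl⟩)
  have key := norm_linearCombination_eq h (Finsupp.single (t + 1) 1 - l)
  simp only [map_sub, Finsupp.linearCombination_single, one_smul] at key
  calc ‖e‖ ≤ ‖w (t + 1) - Finsupp.linearCombination ℝ w l‖ := (he.norm_le hx).trans_eq key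
    _ = ‖f + (w (t + 1) - f - Finsupp.linearCombination ℝ w l)‖ := by congr 1; abel
    _ ≤ ‖f‖ + ‖w (t + 1) - f - Finsupp.linearCombination ℝ w l‖ := norm_add_le _ _
    _ ≤ ‖f‖ + δ := by rw [← dist_eq_norm]; gcongr

/-- A weakly stationary sequence: inner products depend on the time lag only. -/
def IsStationary (y : ℤ → H) : Prop := ∀ s t : ℤ, ⟪y s, y t⟫_ℝ = ⟪y (s - t), y 0⟫_ℝ

/-- Filtering a stationary sequence with two polynomials of equal autocorrelation, that is, of equal
modulus on the unit circle, gives the same Gram matrix. -/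
lemma IsStationary.inner_quadFilter_eq {y : ℤ → H} (hy : IsStationary y) {c r : Fin 3 → ℝ}
    (h0 : c 0 ^ 2 + c 1 ^ 2 + c 2 ^ 2 = r 0 ^ 2 + r 1 ^ 2 + r 2 ^ 2)
    (h1 : c 0 * c 1 + c 1 * c 2 = r 0 * r 1 + r 1 * r 2) (h2 : c 0 * c 2 = r 0 * r 2) (s t : ℤ) :
    ⟪quadFilter c y s, quadFilter c y t⟫_ℝ = ⟪quadFilter r y s, quadFilter r y t⟫_ℝ := by
  have e1 : s - (t - 1) = s - t + 1 := by ring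
  have e2 : s - (t - 2) = s - t + 2 := by ring
  have e3 : s - 1 - t = s - t - 1 := by ring
  have e4 : s - 1 - (t - 1) = s - t := by ring
  have e5 : s - 1 - (t - 2) = s - t + 1 := by ring
  have e6 : s - 2 - t = s - t - 2 := by ring
  have e7 : s - 2 - (t - 1) = s - t - 1 := by ring
  have e8 : s - 2 - (t - 2) = s - t := by ring
  simp only [quadFilter, inner_add_left, inner_add_right, real_inner_smul_left,
    real_inner_smul_right]
  simp only [hy s, hy (s - 1), hy (s - 2), e1, e2, e3, e4, e5, e6, e7, e8]
  linear_combination ⟪y (s - t), y 0⟫_ℝ * h0 +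
    (⟪y (s - t + 1), y 0⟫_ℝ + ⟪y (s - t - 1), y 0⟫_ℝ) * h1 +
    (⟪y (s - t + 2), y 0⟫_ℝ + ⟪y (s - t - 2), y 0⟫_ℝ) * h2

lemma IsStationary.norm_eq {y : ℤ → H} (hy : IsStationary y) (t : ℤ) : ‖y t‖ = ‖y 0‖ := by
  have := hy t t
  rw [sub_self, real_inner_self_eq_norm_sq, real_inner_self_eq_norm_sq] at this
  exact (sq_eq_sq₀ (norm_nonneg _) (norm_nonneg _)).1 this

end Hilbert

/-! ### Minimum phase recurrences -/

/-- A minimum phase condition on `r 0 + r 1 z + r 2 z²`: the recurrence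
`r 0 a k + r 1 a (k + 1) + r 2 a (k + 2) = 0` has no bounded solution that is nonzero at `0`. It holds
when all roots lie outside the closed unit disc. -/
def IsMinimumPhase (r : Fin 3 → ℝ) : Prop :=
  ∀ a : ℕ → ℝ, (∃ C, ∀ k, |a k| ≤ C) →
    (∀ k, r 0 * a k + r 1 * a (k + 1) + r 2 * a (k + 2) = 0) → a 0 = 0

/-- A bounded sequence that a stride `d` expands by a factor greater than `1` starts at zero. -/
lemma eq_zero_of_expanding {a : ℕ → ℝ} {C q : ℝ} (hC : ∀ k, |a k| ≤ C) (hq : 1 < q) {d : ℕ}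
    (h : ∀ k, |a (k + d)| = q * |a k|) : a 0 = 0 := by
  have hpow : ∀ n : ℕ, |a (n * d)| = q ^ n * |a 0| := by
    intro n
    induction n with
    | zero => simp
    | succ n ih => rw [Nat.succ_mul, h, ih, pow_succ]; ring
  by_contra h0
  have hpos : 0 < |a 0| := abs_pos.2 h0
  obtain ⟨n, hn⟩ := pow_unbounded_of_one_lt (C / |a 0|) hq
  have := hC (n * d)
  rw [hpow, ← le_div_iff₀ hpos] at this
  exact absurd hn (not_lt.2 this)

lemma isMinimumPhase_linear {g : ℝ} (hg : 1 < |g|) : IsMinimumPhase ![g, 1, 0] := by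
  rintro a ⟨C, hC⟩ h
  refine eq_zero_of_expanding hC hg (d := 1) fun k => ?_
  have hk := h k
  simp only [Matrix.cons_val] at hk
  rw [← abs_mul, ← abs_neg]
  congr 1
  linarith

lemma isMinimumPhase_even {α : ℝ} (hα : 1 < α) : IsMinimumPhase ![-α, 0, 1] := by
  rintro a ⟨C, hC⟩ h
  refine eq_zero_of_expanding hC hα (d := 2) fun k => ?_
  have hk := h k
  simp only [Matrix.cons_val] at hk
  rw [show a (k + 2) = α * a k by linarith, abs_mul, abs_of_pos (zero_lt_one.trans hα)]

/-- The roots of `α + α z + z²` may be complex or real, so the recurrence is controlled by a Lyapunov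
function instead of its roots: the positive definite form `Q` below satisfies
`Q (a (k+1), a (k+2)) - Q (a k, a (k+1)) = (2α + 1)(α - 1) (a k)²`. If `a` is bounded then so is `Q`,
so it converges and its increments, hence `a k` and `Q` itself, tend to `0`. As `Q` is nondecreasing,
its first value is at most `0`, which forces `a 0 = 0`. -/
lemma isMinimumPhase_quadratic {α : ℝ} (hα : 1 < α) : IsMinimumPhase ![α, α, 1] := by
  rintro a ⟨C, hC⟩ h
  have hrec : ∀ k, a (k + 2) = -α * (a k + a (k + 1)) := fun k => by
    have := h k
    simp only [Matrix.cons_val] at this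
    linarith
  set p : ℝ := α ^ 3 - α ^ 2 + α + 1 with hp
  let Q : ℕ → ℝ := fun k =>
    p * a k ^ 2 + 2 * α ^ 2 * (a k * a (k + 1)) + (1 + α) * a (k + 1) ^ 2
  have hstep : ∀ k, Q (k + 1) - Q k = (2 * α + 1) * (α - 1) * a k ^ 2 := fun k => by
    simp only [Q, hrec k, hp]
    ring
  have hc : 0 < (2 * α + 1) * (α - 1) := mul_pos (by linarith) (by linarith)
  have hpos : ∀ k, (2 * α + 1) * a k ^ 2 ≤ (1 + α) * Q k := fun k => by
    have : (1 + α) * Q k = (2 * α + 1) * a k ^ 2 + (α ^ 2 * a k + (1 + α) * a (k + 1)) ^ 2 := by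
      simp only [Q, hp]
      ring
    rw [this]
    exact le_add_of_nonneg_right (sq_nonneg _)
  have hmono : Monotone Q := monotone_nat_of_le_succ fun k => by
    have := hstep k
    have : 0 ≤ (2 * α + 1) * (α - 1) * a k ^ 2 := mul_nonneg hc.le (sq_nonneg _)
    linarith
  have hbound : ∀ k, Q k ≤ (|p| + 2 * α ^ 2 + (1 + α)) * C ^ 2 := fun k => by
    have hC0 : 0 ≤ C := (abs_nonneg _).trans (hC 0)
    have hsq : ∀ k, a k ^ 2 ≤ C ^ 2 := fun k => sq_le_sq' (abs_le.1 (hC k)).1 (abs_le.1 (hC k)).2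
    have hmul : a k * a (k + 1) ≤ C ^ 2 := by
      nlinarith [hsq k, hsq (k + 1), sq_nonneg (a k - a (k + 1))]
    have h1 : p * a k ^ 2 ≤ |p| * C ^ 2 :=
      (mul_le_mul_of_nonneg_right (le_abs_self p) (sq_nonneg _)).trans
        (mul_le_mul_of_nonneg_left (hsq k) (abs_nonneg p))
    have h2 : 2 * α ^ 2 * (a k * a (k + 1)) ≤ 2 * α ^ 2 * C ^ 2 :=
      mul_le_mul_of_nonneg_left hmul (by positivity)
    have h3 : (1 + α) * a (k + 1) ^ 2 ≤ (1 + α) * C ^ 2 :=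
      mul_le_mul_of_nonneg_left (hsq _) (by linarith)
    simp only [Q]
    linarith
  obtain ⟨q, hq⟩ : ∃ q, Tendsto Q atTop (𝓝 q) :=
    ⟨_, tendsto_atTop_ciSup hmono ⟨_, Set.forall_mem_range.2 hbound⟩⟩
  have ha2 : Tendsto (fun k => a k ^ 2) atTop (𝓝 0) := by
    have hdiff := ((hq.comp (tendsto_add_atTop_nat 1)).sub hq).const_mul
      ((2 * α + 1) * (α - 1))⁻¹
    rw [sub_self, mul_zero] at hdiff
    refine hdiff.congr fun k => ?_
    simp only [Function.comp_apply, hstep]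
    exact inv_mul_cancel_left₀ hc.ne' _
  have ha : Tendsto a atTop (𝓝 0) := by
    have := (Real.continuous_sqrt.tendsto 0).comp ha2
    rw [Real.sqrt_zero] at this
    refine (tendsto_zero_iff_abs_tendsto_zero _).2 (this.congr fun k => ?_)
    simp [Real.sqrt_sq_eq_abs]
  have ha1 := ha.comp (tendsto_add_atTop_nat 1)
  have hQ0 : Tendsto Q atTop (𝓝 0) := by
    have := (((ha.pow 2).const_mul p).add ((ha.mul ha1).const_mul (2 * α ^ 2))).add
      ((ha1.pow 2).const_mul (1 + α))
    simpa [Q] using this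
  have hle : Q 0 ≤ 0 := hmono.ge_of_tendsto hQ0 0
  have h1 := hpos 0
  have : a 0 ^ 2 ≤ 0 := by nlinarith [sq_nonneg (a 0)]
  exact pow_eq_zero_iff two_ne_zero |>.1 (le_antisymm this (sq_nonneg _))

section Hilbert

variable {H : Type*} [NormedAddCommGroup H] [InnerProductSpace ℝ H]

/-! ### Innovations of filtered moving averages -/

/-- A minimum phase filter loses no information: projected to the orthogonal complement of the past
of the output, the input would be a bounded solution of the homogeneous recurrence. -/
lemma IsMinimumPhase.mem_linearPast [CompleteSpace H] {r : Fin 3 → ℝ} (hr : IsMinimumPhase r)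
    {y : ℤ → H} (hy : IsStationary y) (t : ℤ) : y t ∈ linearPast (quadFilter r y) t := by
  have : CompleteSpace (linearPast (quadFilter r y) t) :=
    (isClosed_linearPast _ t).completeSpace_coe
  rw [← Submodule.orthogonal_orthogonal (linearPast (quadFilter r y) t), Submodule.mem_orthogonal]
  intro v hv
  have key := hr (fun k => ⟪v, y (t - k)⟫_ℝ) ⟨‖v‖ * ‖y 0‖, fun k => ?_⟩ fun k => ?_
  · simpa using key
  · rw [← hy.norm_eq (t - k)]
    exact abs_real_inner_le_norm _ _
  · have h0 : ⟪v, quadFilter r y (t - k)⟫_ℝ = 0 :=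
      Submodule.inner_left_of_mem_orthogonal
        (DemandAllocation.mem_linearPast _ (by omega : t - k ≤ t)) hv
    have e1 : t - k - 1 = t - ((k + 1 : ℕ) : ℤ) := by push_cast; ring
    have e2 : t - k - 2 = t - ((k + 2 : ℕ) : ℤ) := by push_cast; ring
    rw [quadFilter, inner_add_right, inner_add_right, real_inner_smul_right, real_inner_smul_right,
      real_inner_smul_right, e1, e2] at h0
    exact h0

/-- The moving average `y t = ∑ₖ ψₖ e (t - k)`, as a convergent series in `H`. -/
def IsMovingAverage (ψ : PowerSeries ℝ) (e y : ℤ → H) : Prop :=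
  ∀ t : ℤ, Tendsto (fun K : ℕ => ∑ k ∈ Finset.range K, PowerSeries.coeff k ψ • e (t - k)) atTop
    (𝓝 (y t))

lemma IsMovingAverage.mem_linearPast {ψ : PowerSeries ℝ} {e y : ℤ → H}
    (h : IsMovingAverage ψ e y) (t : ℤ) : y t ∈ linearPast e t :=
  (isClosed_linearPast e t).mem_of_tendsto (h t) <| Eventually.of_forall fun _ =>
    Submodule.sum_mem _ fun k _ => Submodule.smul_mem _ _
      (DemandAllocation.mem_linearPast _ (by omega))

lemma IsMovingAverage.sub_mem_linearPast {ψ : PowerSeries ℝ} {e y : ℤ → H}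
    (h : IsMovingAverage ψ e y) (t : ℤ) :
    y (t + 1) - PowerSeries.constantCoeff ψ • e (t + 1) ∈ linearPast e t := by
  refine (isClosed_linearPast e t).mem_of_tendsto
    (((h (t + 1)).comp (tendsto_add_atTop_nat 1)).sub_const _) <| Eventually.of_forall fun K => ?_
  simp only [Function.comp_apply]
  rw [Finset.sum_range_succ']
  simp only [Nat.cast_zero, sub_zero, PowerSeries.coeff_zero_eq_constantCoeff,
    add_sub_cancel_right]
  exact Submodule.sum_mem _ fun k _ => Submodule.smul_mem _ _
    (DemandAllocation.mem_linearPast _ (by push_cast; omega))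

lemma IsMovingAverage.isStationary {ψ : PowerSeries ℝ} {e y : ℤ → H} (he : Orthonormal ℝ e)
    (h : IsMovingAverage ψ e y) : IsStationary y := by
  intro s t
  refine tendsto_nhds_unique ((h s).inner (h t)) (((h (s - t)).inner (h 0)).congr fun K => ?_)
  simp only [sum_inner, inner_sum, real_inner_smul_left, real_inner_smul_right,
    orthonormal_iff_ite.1 he]
  refine Finset.sum_congr rfl fun i _ => Finset.sum_congr rfl fun j _ => ?_
  congr 3
  exact propext ⟨fun h => by omega, fun h => by omega⟩

lemma orthonormal_mem_orthogonal {e : ℤ → H} (he : Orthonormal ℝ e) {s t : ℤ} (h : t < s) :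
    e s ∈ (linearPast e t)ᗮ := by
  have hle : linearPast e t ≤ (ℝ ∙ e s)ᗮ := by
    refine linearPast_le (Submodule.isClosed_orthogonal _) fun r hr => ?_
    rw [Submodule.mem_orthogonal_singleton_iff_inner_right]
    exact he.2 (by omega)
  rw [Submodule.mem_orthogonal']
  intro u hu
  exact Submodule.mem_orthogonal_singleton_iff_inner_right.1 (hle hu)

/-- Invertibility forces `ψ₀ ≠ 0`: otherwise `y` at time `t` would lie in the past of the shocks
before `t`, and could not carry the shock at `t`. -/
lemma IsMovingAverage.constantCoeff_ne_zero {ψ : PowerSeries ℝ} {e y : ℤ → H}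
    (he : Orthonormal ℝ e) (h : IsMovingAverage ψ e y) (hinv : ∀ t, e t ∈ linearPast y t) :
    PowerSeries.constantCoeff ψ ≠ 0 := by
  intro h0
  have hle : linearPast y 0 ≤ linearPast e (-1) := by
    refine linearPast_le (isClosed_linearPast e _) fun s hs => ?_
    have := h.sub_mem_linearPast (s - 1)
    rw [h0, zero_smul, sub_zero, sub_add_cancel] at this
    exact linearPast_mono e (by omega) this
  have hzero : ⟪e 0, e 0⟫_ℝ = 0 := Submodule.inner_left_of_mem_orthogonal (hle (hinv 0))
    (orthonormal_mem_orthogonal he (by norm_num))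
  rw [inner_self_eq_zero] at hzero
  exact he.ne_zero 0 hzero

/-- The innovation of a minimum phase filter of an invertible moving average is the contribution of
the newest shock. -/
lemma IsMovingAverage.isInnovation_of_isMinimumPhase [CompleteSpace H] {ψ : PowerSeries ℝ}
    {e y : ℤ → H} (he : Orthonormal ℝ e) (h : IsMovingAverage ψ e y)
    (hinv : ∀ t, e t ∈ linearPast y t) {r : Fin 3 → ℝ} (hr : IsMinimumPhase r) (t : ℤ) :
    IsInnovation (quadFilter r y) t ((r 0 * PowerSeries.constantCoeff ψ) • e (t + 1)) := by
  have hy := h.isStationary he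
  have hye : ∀ s ≤ t, y s ∈ linearPast e t := fun s hs =>
    linearPast_mono e hs (h.mem_linearPast s)
  have hle : linearPast (quadFilter r y) t ≤ linearPast e t :=
    linearPast_le (isClosed_linearPast e t) fun s hs =>
      quadFilter_mem fun u hu => hye u (hu.trans hs)
  have hyw : linearPast y t ≤ linearPast (quadFilter r y) t :=
    linearPast_le (isClosed_linearPast _ t) fun s hs =>
      linearPast_mono _ hs (hr.mem_linearPast hy s)
  have hge : linearPast e t ≤ linearPast (quadFilter r y) t :=
    linearPast_le (isClosed_linearPast _ t) fun s hs =>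
      hyw (linearPast_mono y hs (hinv s))
  refine ⟨Submodule.smul_mem _ _ (Submodule.orthogonal_le hle
    (orthonormal_mem_orthogonal he (by omega))), hge ?_⟩
  have hsplit : quadFilter r y (t + 1) - (r 0 * PowerSeries.constantCoeff ψ) • e (t + 1) =
      r 0 • (y (t + 1) - PowerSeries.constantCoeff ψ • e (t + 1)) + r 1 • y (t + 1 - 1) +
        r 2 • y (t + 1 - 2) := by
    rw [quadFilter, mul_smul, smul_sub]
    abel
  rw [hsplit]
  exact Submodule.add_mem _ (Submodule.add_mem _
    (Submodule.smul_mem _ _ (h.sub_mem_linearPast t))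
    (Submodule.smul_mem _ _ (hye _ (by omega)))) (Submodule.smul_mem _ _ (hye _ (by omega)))

/-- One-step prediction error of a filtered invertible moving average: if `c` shares its
autocorrelation with a minimum phase `r`, the innovations of `c(B) y` have norm `|r 0 ψ₀|`. -/
theorem IsMovingAverage.exists_isInnovation_norm_eq [CompleteSpace H] {ψ : PowerSeries ℝ}
    {e y : ℤ → H} (he : Orthonormal ℝ e) (h : IsMovingAverage ψ e y)
    (hinv : ∀ t, e t ∈ linearPast y t) {c r : Fin 3 → ℝ} (hr : IsMinimumPhase r)
    (h0 : c 0 ^ 2 + c 1 ^ 2 + c 2 ^ 2 = r 0 ^ 2 + r 1 ^ 2 + r 2 ^ 2)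
    (h1 : c 0 * c 1 + c 1 * c 2 = r 0 * r 1 + r 1 * r 2) (h2 : c 0 * c 2 = r 0 * r 2) (t : ℤ) :
    ∃ f, IsInnovation (quadFilter c y) t f ∧ ‖f‖ = |r 0 * PowerSeries.constantCoeff ψ| := by
  have hy := h.isStationary he
  obtain ⟨f, hf⟩ := exists_isInnovation (quadFilter c y) t
  have hw := h.isInnovation_of_isMinimumPhase he hinv hr t
  have hgram := hy.inner_quadFilter_eq h0 h1 h2
  refine ⟨f, hf, ?_⟩
  rw [(hf.norm_le_of_inner_eq hw hgram).antisymm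
    (hw.norm_le_of_inner_eq hf fun s r => (hgram s r).symm), norm_smul, he.1, mul_one,
    Real.norm_eq_abs]

end Hilbert

/-! ### The Gaussian Hilbert space of the shocks -/

section Gaussian

variable {P : Measure Ω}

lemma inner_Lp_eq_integral_mul (Z W : Lp ℝ 2 P) : ⟪Z, W⟫_ℝ = ∫ ω, Z ω * W ω ∂P := by
  rw [L2.inner_def]
  refine integral_congr_ae (Eventually.of_forall fun ω => ?_)
  simp [mul_comm]

/-- The closed linear span in `L²(P)` of the shocks `e t`. -/
def gaussianSpan (e : ℤ → Lp ℝ 2 P) : Submodule ℝ (Lp ℝ 2 P) :=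
  (Submodule.span ℝ (Set.range e)).topologicalClosure

lemma linearPast_le_gaussianSpan (e : ℤ → Lp ℝ 2 P) (t : ℤ) : linearPast e t ≤ gaussianSpan e :=
  Submodule.topologicalClosure_mono (Submodule.span_mono (Set.image_subset_range _ _))

variable {ε : ℤ → Ω → ℝ} {e : ℤ → Lp ℝ 2 P}

lemma map_eq_gaussianReal_of_mem_span (hε : IsGaussianWhiteNoise P ε)
    (he : ∀ t, e t =ᵐ[P] ε t) {Z : Lp ℝ 2 P} (hZ : Z ∈ Submodule.span ℝ (Set.range e)) :
    P.map Z = gaussianReal 0 (‖Z‖₊ ^ 2) := by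
  obtain ⟨c, rfl⟩ := Finsupp.mem_span_range_iff_exists_finsupp.1 hZ
  set Z := c.sum fun t a => a • e t
  have hae : Z =ᵐ[P] fun ω => ∑ t ∈ c.support, c t • ε t ω := by
    have h1 : Z =ᵐ[P] ∑ t ∈ c.support, ⇑(c t • e t) :=
      Lp.coeFn_finsetSum c.support fun t => c t • e t
    have h2 : ∀ᵐ ω ∂P, ∀ t, (c t • e t) ω = c t • ε t ω := by
      rw [ae_all_iff]
      intro t
      filter_upwards [Lp.coeFn_smul (c t) (e t), he t] with ω h h'
      rw [h, Pi.smul_apply, h']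
    filter_upwards [h1, h2] with ω h h'
    rw [h, Finset.sum_apply]
    exact Finset.sum_congr rfl fun t _ => h' t
  have hlaw : HasGaussianLaw Z P :=
    ((hε.gaussian.smul c).hasGaussianLaw_fun_sum (I := c.support)).congr hae.symm
  have hmean : P[Z] = 0 := by
    rw [integral_congr_ae hae, integral_finsetSum]
    · refine Finset.sum_eq_zero fun t _ => ?_
      simp_rw [smul_eq_mul]
      rw [integral_const_mul, hε.mean_eq_zero, mul_zero]
    · exact fun t _ => (hε.gaussian.hasGaussianLaw_eval t).integrable.const_mul _
  rw [hlaw.map_eq_gaussianReal, hmean, variance_of_integral_eq_zero hlaw.aemeasurable hmean]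
  congr 1
  rw [← NNReal.coe_inj, Real.coe_toNNReal _ (integral_nonneg fun _ => sq_nonneg _)]
  push_cast
  rw [← real_inner_self_eq_norm_sq, inner_Lp_eq_integral_mul]
  simp [pow_two]

variable [IsProbabilityMeasure P]

lemma integral_norm_le_norm_Lp (Z : Lp ℝ 2 P) : ∫ ω, ‖Z ω‖ ∂P ≤ ‖Z‖ := by
  rw [integral_norm_eq_lintegral_enorm (Lp.aestronglyMeasurable Z), Lp.norm_def,
    ← eLpNorm_one_eq_lintegral_enorm]
  exact ENNReal.toReal_mono (Lp.eLpNorm_ne_top Z)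
    (eLpNorm_le_eLpNorm_of_exponent_le one_le_two (Lp.aestronglyMeasurable Z))

lemma continuous_charFun_map_Lp (u : ℝ) :
    Continuous fun Z : Lp ℝ 2 P => charFun (P.map Z) u := by
  have hint : ∀ Z : Lp ℝ 2 P, Integrable (fun ω => Complex.exp (u * Z ω * Complex.I)) P := by
    intro Z
    refine Integrable.of_bound (C := 1) ?_ (Eventually.of_forall fun ω => ?_)
    · exact (by fun_prop : Continuous fun x : ℝ =>
        Complex.exp (u * x * Complex.I)).comp_aestronglyMeasurable (Lp.aestronglyMeasurable Z)
    · rw [← Complex.ofReal_mul, Complex.norm_exp_ofReal_mul_I]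
  have heq : ∀ Z : Lp ℝ 2 P,
      charFun (P.map Z) u = ∫ ω, Complex.exp (u * Z ω * Complex.I) ∂P := by
    intro Z
    rw [charFun_apply_real, integral_map (Lp.aestronglyMeasurable Z).aemeasurable]
    exact (by fun_prop : Continuous fun x : ℝ =>
      Complex.exp (u * x * Complex.I)).aestronglyMeasurable
  refine LipschitzWith.continuous (K := ‖u‖₊) (LipschitzWith.of_dist_le_mul fun Z W => ?_)
  rw [heq, heq, dist_eq_norm, dist_eq_norm, ← integral_sub (hint Z) (hint W), coe_nnnorm]
  calc ‖∫ ω, (Complex.exp (u * Z ω * Complex.I) - Complex.exp (u * W ω * Complex.I)) ∂P‖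
      ≤ ∫ ω, ‖u‖ * ‖(Z - W) ω‖ ∂P := by
        refine norm_integral_le_of_norm_le
          (((Lp.memLp (Z - W)).integrable one_le_two).norm.const_mul _) ?_
        filter_upwards [Lp.coeFn_sub Z W] with ω hω
        have hfac : Complex.exp (u * Z ω * Complex.I) - Complex.exp (u * W ω * Complex.I) =
            Complex.exp ((u * W ω : ℝ) * Complex.I) *
              (Complex.exp (Complex.I * (u * (Z ω - W ω) : ℝ)) - 1) := by
          rw [mul_sub, ← Complex.exp_add, mul_one]
          push_cast
          ring_nf
        rw [hfac, norm_mul, Complex.norm_exp_ofReal_mul_I, one_mul, hω, Pi.sub_apply, ← norm_mul]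
        exact Real.norm_exp_I_mul_ofReal_sub_one_le
    _ = ‖u‖ * ∫ ω, ‖(Z - W) ω‖ ∂P := integral_const_mul _ _
    _ ≤ ‖u‖ * ‖Z - W‖ := by gcongr; exact integral_norm_le_norm_Lp _

lemma IsGaussianWhiteNoise.integral_mul (hε : IsGaussianWhiteNoise P ε) (s t : ℤ) :
    ∫ ω, ε s ω * ε t ω ∂P = if s = t then 1 else 0 := by
  rw [← hε.covariance_eq s t, covariance_eq_sub (hε.gaussian.hasGaussianLaw_eval s).memLp_two
    (hε.gaussian.hasGaussianLaw_eval t).memLp_two, hε.mean_eq_zero]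
  simp

lemma IsGaussianWhiteNoise.orthonormal (hε : IsGaussianWhiteNoise P ε)
    (he : ∀ t, e t =ᵐ[P] ε t) : Orthonormal ℝ e := by
  rw [orthonormal_iff_ite]
  intro s t
  rw [inner_Lp_eq_integral_mul, ← hε.integral_mul]
  refine integral_congr_ae ?_
  filter_upwards [he s, he t] with ω hs ht
  rw [hs, ht]

/-- Every element of the closed span of the shocks is a centred Gaussian: laws are continuous along
`L²` limits, as can be read off from characteristic functions. -/
lemma map_eq_gaussianReal (hε : IsGaussianWhiteNoise P ε)
    (he : ∀ t, e t =ᵐ[P] ε t) {Z : Lp ℝ 2 P} (hZ : Z ∈ gaussianSpan e) :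
    P.map Z = gaussianReal 0 (‖Z‖₊ ^ 2) := by
  have : IsProbabilityMeasure (P.map Z) :=
    Measure.isProbabilityMeasure_map (Lp.aestronglyMeasurable Z).aemeasurable
  refine Measure.ext_of_charFun (funext fun u => ?_)
  have hclosed : IsClosed {Z : Lp ℝ 2 P |
      charFun (P.map Z) u = charFun (gaussianReal 0 (‖Z‖₊ ^ 2)) u} := by
    simp only [charFun_gaussianReal]
    refine isClosed_eq (continuous_charFun_map_Lp u) ?_
    fun_prop
  exact closure_minimal (fun W hW => by
    rw [Set.mem_ofPred_eq, map_eq_gaussianReal_of_mem_span hε he hW]) hclosed hZ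

lemma integral_eq_zero_of_mem_gaussianSpan (hε : IsGaussianWhiteNoise P ε)
    (he : ∀ t, e t =ᵐ[P] ε t) {Z : Lp ℝ 2 P} (hZ : Z ∈ gaussianSpan e) : ∫ ω, Z ω ∂P = 0 := by
  have h := integral_map (Lp.aestronglyMeasurable Z).aemeasurable
    (f := fun x : ℝ => x) (by fun_prop)
  rw [← h, map_eq_gaussianReal hε he hZ, integral_id_gaussianReal]

/-- Any family in the closed span of the shocks is jointly Gaussian, because the span is stable under
linear combinations. -/
lemma isGaussianProcess_of_mem_gaussianSpan (hε : IsGaussianWhiteNoise P ε)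
    (he : ∀ t, e t =ᵐ[P] ε t) {ι : Type*} {z : ι → Lp ℝ 2 P} {Z : ι → Ω → ℝ}
    (hz : ∀ i, z i ∈ gaussianSpan e) (hzZ : ∀ i, z i =ᵐ[P] Z i) : IsGaussianProcess Z P := by
  classical
  have hZm : ∀ i, AEMeasurable (Z i) P := fun i =>
    (Lp.aestronglyMeasurable (z i)).aemeasurable.congr (hzZ i)
  refine ⟨fun I => ⟨isGaussian_of_map_eq_gaussianReal fun L => ?_⟩⟩
  have hm : AEMeasurable (fun ω => I.restrict (Z · ω)) P :=
    aemeasurable_pi_lambda _ fun i => hZm i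
  let c : I → ℝ := fun i => L (Pi.single i 1)
  let W : Lp ℝ 2 P := ∑ i : I, c i • z i
  have hW : W ∈ gaussianSpan e :=
    Submodule.sum_mem _ fun i _ => Submodule.smul_mem _ _ (hz i)
  have hae : W =ᵐ[P] fun ω => L (I.restrict (Z · ω)) := by
    have h1 : W =ᵐ[P] ∑ i : I, ⇑(c i • z i) := Lp.coeFn_finsetSum _ fun i : I => c i • z i
    have h2 : ∀ᵐ ω ∂P, ∀ i : I, (c i • z i) ω = c i * Z i ω := by
      rw [ae_all_iff]
      intro i
      filter_upwards [Lp.coeFn_smul (c i) (z i), hzZ i] with ω h h'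
      rw [h, Pi.smul_apply, h', smul_eq_mul]
    filter_upwards [h1, h2] with ω h h'
    have hL := (L : (I → ℝ) →ₗ[ℝ] ℝ).pi_apply_eq_sum_univ (I.restrict (Z · ω))
    rw [ContinuousLinearMap.coe_coe] at hL
    rw [h, Finset.sum_apply, hL]
    refine Finset.sum_congr rfl fun i _ => ?_
    have hsingle : (Pi.single i 1 : I → ℝ) = fun j => if i = j then 1 else 0 := by
      ext j
      simp [Pi.single_apply, eq_comm]
    rw [h', smul_eq_mul, mul_comm]
    simp only [c, hsingle, Finset.restrict]
  refine ⟨0, ‖W‖₊ ^ 2, ?_⟩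
  rw [AEMeasurable.map_map_of_aemeasurable L.continuous.measurable.aemeasurable hm,
    ← map_eq_gaussianReal hε he hW]
  exact Measure.map_congr hae.symm

/-! ### Conditional variance of the forecast error -/

/-- If the innovations of a process in the Gaussian span of the shocks all have norm `s`, then `s` is
its root mean squared forecast error: the innovation, being Gaussian and uncorrelated with the
history, is independent of it, so that the linear prediction is the conditional expectation and the conditional
variance is constant. -/
theorem hasRootMSFE_of_isInnovation (hε : IsGaussianWhiteNoise P ε)
    (he : ∀ t, e t =ᵐ[P] ε t) {X : ℤ → Ω → ℝ} (hX : ∀ t, Measurable (X t)) {μ s : ℝ}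
    {x : ℤ → Lp ℝ 2 P} (hx : ∀ t, x t ∈ gaussianSpan e)
    (hxX : ∀ t, x t =ᵐ[P] fun ω => X t ω - μ) (hs : 0 ≤ s)
    (hinn : ∀ t, ∃ f, IsInnovation x t f ∧ ‖f‖ = s) : HasRootMSFE P X s := by
  have hXx : ∀ t, X t =ᵐ[P] fun ω => x t ω + μ := fun t => by
    filter_upwards [hxX t] with ω h
    rw [h, sub_add_cancel]
  have hL2 : ∀ t, MemLp (X t) 2 P := fun t =>
    ((Lp.memLp (x t)).add (memLp_const μ)).ae_eq (hXx t).symm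
  refine ⟨hs, hL2, fun t => ?_⟩
  obtain ⟨f, hf, rfl⟩ := hinn t
  have hm : history X t ≤ ‹MeasurableSpace Ω› := iSup_le fun r => (hX r).comap_le
  have hXmeas : ∀ r ≤ t, Measurable[history X t] (X r) := fun r hr =>
    measurable_iff_comap_le.2 (le_iSup (fun r : Set.Iic t =>
      MeasurableSpace.comap (X r) inferInstance) ⟨r, hr⟩)
  -- The linear prediction `v` is measurable with respect to the history.
  set v : Lp ℝ 2 P := x (t + 1) - f with hv
  have hvmeas : AEStronglyMeasurable[history X t] v P := by
    have : Fact (history X t ≤ ‹MeasurableSpace Ω›) := ⟨hm⟩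
    have hle : linearPast x t ≤ lpMeas ℝ ℝ (history X t) 2 P := by
      refine linearPast_le (isClosed_aestronglyMeasurable hm) fun r hr => ?_
      rw [mem_lpMeas_iff_aestronglyMeasurable]
      exact ((hXmeas r hr).sub_const μ).stronglyMeasurable.aestronglyMeasurable.congr
        (hxX r).symm
    exact mem_lpMeas_iff_aestronglyMeasurable.1 (hle hf.sub_mem)
  -- The innovation `f` is independent of the history.
  have hxe : linearPast x t ≤ gaussianSpan e :=
    linearPast_le (Submodule.isClosed_topologicalClosure _) fun r _ => hx r
  have hfe : f ∈ gaussianSpan e := by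
    have := (gaussianSpan e).sub_mem (hx (t + 1)) (hxe hf.sub_mem)
    rwa [sub_sub_cancel] at this
  have hfm : StronglyMeasurable f := Lp.stronglyMeasurable f
  have hindep : Indep (MeasurableSpace.comap f inferInstance) (history X t) P := by
    have hgauss : IsGaussianProcess (Sum.elim (fun _ : Unit => (f : Ω → ℝ))
        fun r : Set.Iic t => fun ω => X r ω - μ) P := by
      refine isGaussianProcess_of_mem_gaussianSpan hε he
        (z := Sum.elim (fun _ => f) fun r : Set.Iic t => x r) ?_ ?_
      · rintro (_ | r)
        exacts [hfe, hx r]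
      · rintro (_ | r)
        exacts [ae_eq_rfl, hxX r]
    have hind := hgauss.indepFun_of_covariance_eq_zero
      (fun _ => hfm.measurable.aemeasurable)
      (fun r => ((hX r).sub_const μ).aemeasurable) fun _ r => by
        have hXr : MemLp (fun ω => X r ω - μ) 2 P := (hL2 r).sub (memLp_const μ)
        rw [covariance_eq_sub (Lp.memLp f) hXr,
          integral_eq_zero_of_mem_gaussianSpan hε he hfe, zero_mul, sub_zero,
          ← Submodule.inner_left_of_mem_orthogonal (mem_linearPast x r.2) hf.orthogonal,
          inner_Lp_eq_integral_mul]
        refine integral_congr_ae ?_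
        filter_upwards [hxX r] with ω h
        rw [Pi.mul_apply, h]
    refine indep_of_indep_of_le_left
      (indep_of_indep_of_le_right ((IndepFun_iff_Indep _ _ _).1 hind) ?_) ?_
    · refine iSup_le fun r => ?_
      have : X r = (fun g : Set.Iic t → ℝ => g r + μ) ∘ fun ω (r : Set.Iic t) => X r ω - μ := by
        ext ω
        simp
      rw [this, ← MeasurableSpace.comap_comp]
      exact MeasurableSpace.comap_mono (Measurable.comap_le (by fun_prop))
    · have : (f : Ω → ℝ) = (fun g : Unit → ℝ => g ()) ∘ fun ω (_ : Unit) => f ω := rfl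
      rw [this, ← MeasurableSpace.comap_comp]
      exact MeasurableSpace.comap_mono (Measurable.comap_le (by fun_prop))
  have hcond : ∀ g : ℝ → ℝ, Measurable g →
      P[fun ω => g (f ω) | history X t] =ᵐ[P] fun _ => ∫ ω, g (f ω) ∂P := fun g hg =>
    condExp_indep_eq hfm.measurable.comap_le hm
      (hg.comp (comap_measurable (f : Ω → ℝ))).stronglyMeasurable hindep
  have hf0 : P[f | history X t] =ᵐ[P] fun _ => 0 := by
    rw [← integral_eq_zero_of_mem_gaussianSpan hε he hfe]
    exact hcond id measurable_id
  have hfint : Integrable f P := (Lp.memLp f).integrable one_le_two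
  have hvint : Integrable (fun ω => v ω + μ) P :=
    ((Lp.memLp v).integrable one_le_two).add (integrable_const μ)
  have hsplit : X (t + 1) =ᵐ[P] (fun ω => v ω + μ) + f := by
    filter_upwards [hXx (t + 1), Lp.coeFn_sub (x (t + 1)) f] with ω h h'
    rw [h, Pi.add_apply, hv, h', Pi.sub_apply]
    ring
  have hforecast : forecast P X t =ᵐ[P] fun ω => v ω + μ := by
    refine (condExp_congr_ae hsplit).trans ((condExp_add hvint hfint _).trans ?_)
    have hvc := condExp_of_aestronglyMeasurable' hm
      (hvmeas.add (aestronglyMeasurable_const (b := μ))) hvint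
    filter_upwards [hvc, hf0] with ω h h'
    rw [Pi.add_apply, h', add_zero]
    exact h
  have herr : (fun ω => X (t + 1) ω - forecast P X t ω) =ᵐ[P] f := by
    filter_upwards [hsplit, hforecast] with ω h h'
    rw [h, h', Pi.add_apply, add_sub_cancel_left]
  refine (condVar_congr_ae herr).trans ?_
  have hsq : ((f : Ω → ℝ) - P[f | history X t]) ^ 2 =ᵐ[P] fun ω => f ω ^ 2 := by
    filter_upwards [hf0] with ω h
    rw [Pi.pow_apply, Pi.sub_apply, h, sub_zero]
  refine (condExp_congr_ae hsq).trans ((hcond (· ^ 2) (by fun_prop)).trans ?_)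
  rw [← real_inner_self_eq_norm_sq, inner_Lp_eq_integral_mul]
  simp [pow_two]

end Gaussian

/-! ### Causal filters in `L²(P)` -/

section Filters

variable {H : Type*} [NormedAddCommGroup H] [InnerProductSpace ℝ H] {f g : PowerSeries ℝ}
  {e x x' y : ℤ → H}

lemma isMovingAverage_one (e : ℤ → H) : IsMovingAverage 1 e e := fun t => by
  refine tendsto_const_nhds.congr' ?_
  filter_upwards [eventually_ge_atTop 1] with K hK
  rw [Finset.sum_eq_single_of_mem 0 (Finset.mem_range.2 hK)
    fun k _ hk => by rw [PowerSeries.coeff_one, if_neg hk, zero_smul]]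
  simp

lemma IsMovingAverage.add (hf : IsMovingAverage f e x) (hg : IsMovingAverage g e x') :
    IsMovingAverage (f + g) e fun t => x t + x' t := fun t => by
  simpa only [map_add, add_smul, Finset.sum_add_distrib] using (hf t).add (hg t)

lemma IsMovingAverage.const_mul (a : ℝ) (hf : IsMovingAverage f e x) :
    IsMovingAverage (PowerSeries.C a * f) e fun t => a • x t := fun t => by
  simpa only [PowerSeries.coeff_C_mul, mul_smul, Finset.smul_sum] using (hf t).const_smul a

lemma IsMovingAverage.backshift (hf : IsMovingAverage f e x) :
    IsMovingAverage (PowerSeries.X * f) e fun t => x (t - 1) := fun t => by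
  refine (tendsto_add_atTop_iff_nat 1).1 ((hf (t - 1)).congr fun K => ?_)
  rw [Finset.sum_range_succ', PowerSeries.coeff_zero_X_mul, zero_smul, add_zero]
  refine Finset.sum_congr rfl fun k _ => ?_
  rw [PowerSeries.coeff_succ_X_mul]
  congr 2
  push_cast
  ring

/-- The power series `c 0 + c 1 z + c 2 z²`. -/
def quadSeries (c : Fin 3 → ℝ) : PowerSeries ℝ :=
  PowerSeries.C (c 0) + PowerSeries.C (c 1) * PowerSeries.X +
    PowerSeries.C (c 2) * PowerSeries.X ^ 2

lemma isSquareSummable_quadSeries (c : Fin 3 → ℝ) : IsSquareSummable (quadSeries c) := by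
  refine summable_of_ne_finset_zero (s := Finset.range 3) fun k hk => ?_
  have hk3 : 3 ≤ k := by simpa using hk
  have h0 : k ≠ 0 := by omega
  have h1 : k ≠ 1 := by omega
  have h2 : k ≠ 2 := by omega
  simp [quadSeries, PowerSeries.coeff_C, PowerSeries.coeff_X, PowerSeries.coeff_X_pow, h0, h1, h2]

lemma IsMovingAverage.quadFilter (c : Fin 3 → ℝ) (hf : IsMovingAverage f e x) :
    IsMovingAverage (quadSeries c * f) e (quadFilter c x) := by
  have h := ((hf.const_mul (c 0)).add (hf.backshift.const_mul (c 1))).add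
    (hf.backshift.backshift.const_mul (c 2))
  have hs : quadSeries c * f = PowerSeries.C (c 0) * f + PowerSeries.C (c 1) * (PowerSeries.X * f) +
      PowerSeries.C (c 2) * (PowerSeries.X * (PowerSeries.X * f)) := by
    rw [quadSeries]
    ring
  rw [hs]
  convert h using 2 with t
  rw [DemandAllocation.quadFilter, sub_sub]
  norm_num

lemma isMovingAverage_quadSeries_iff {c : Fin 3 → ℝ} :
    IsMovingAverage (quadSeries c) e x ↔ x = quadFilter c e := by
  have h := (isMovingAverage_one e).quadFilter c
  rw [mul_one] at h
  exact ⟨fun hx => funext fun t => tendsto_nhds_unique (hx t) (h t), fun hx => hx ▸ h⟩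

end Filters

section Lp

variable {P : Measure Ω} {Y X : ℤ → Ω → ℝ} {y x : ℤ → Lp ℝ 2 P} {f : PowerSeries ℝ}

lemma coeFn_sum_range_smul (hy : ∀ t, y t =ᵐ[P] Y t) (c : ℕ → ℝ) (K : ℕ) (t : ℤ) :
    ⇑(∑ k ∈ Finset.range K, c k • y (t - k)) =ᵐ[P]
      fun ω => ∑ k ∈ Finset.range K, c k * Y (t - k) ω := by
  have h : ∀ᵐ ω ∂P, ∀ k : ℕ, (c k • y (t - k)) ω = c k * Y (t - k) ω := by
    rw [ae_all_iff]
    intro k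
    filter_upwards [Lp.coeFn_smul (c k) (y (t - k)), hy (t - k)] with ω h h'
    rw [h, Pi.smul_apply, h', smul_eq_mul]
  filter_upwards [Lp.coeFn_finsetSum (Finset.range K) fun k => c k • y (t - k), h] with ω h h'
  rw [h, Finset.sum_apply]
  exact Finset.sum_congr rfl fun k _ => h' k

/-- Filtering of random variables is the convergence of a series in the Hilbert space `L²(P)`. -/
lemma isFilterOutput_iff (hy : ∀ t, y t =ᵐ[P] Y t) (hx : ∀ t, x t =ᵐ[P] X t) :
    IsFilterOutput P f Y X ↔ IsMovingAverage f y x := by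
  refine forall_congr' fun t => ?_
  rw [Lp.tendsto_Lp_iff_tendsto_eLpNorm']
  refine iff_of_eq (congrArg (fun u : ℕ → ℝ≥0∞ => Tendsto u atTop (𝓝 0)) (funext fun K => ?_))
  rw [eLpNorm_sub_comm]
  refine eLpNorm_congr_ae ?_
  filter_upwards [coeFn_sum_range_smul hy (fun k => PowerSeries.coeff k f) K t, hx t] with ω h h'
  rw [Pi.sub_apply, h, h']

lemma IsFilterOutput.memLp (h : IsFilterOutput P f Y X) (hY : ∀ t, MemLp (Y t) 2 P)
    (hX : ∀ t, AEStronglyMeasurable (X t) P) (t : ℤ) : MemLp (X t) 2 P := by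
  obtain ⟨K, hK⟩ := ((h t).eventually_lt_const zero_lt_one).exists
  have hsum : MemLp (fun ω => ∑ k ∈ Finset.range K, PowerSeries.coeff k f * Y (t - k) ω) 2 P :=
    memLp_finsetSum _ fun k _ => (hY _).const_mul _
  have hdiff : MemLp (fun ω => X t ω -
      ∑ k ∈ Finset.range K, PowerSeries.coeff k f * Y (t - k) ω) 2 P :=
    ⟨(hX t).sub hsum.1, hK.trans ENNReal.one_lt_top⟩
  convert hdiff.add hsum using 1
  ext ω
  simp

lemma IsInvertible.mem_linearPast {m : ℝ} {ε D : ℤ → Ω → ℝ} {e : ℤ → Lp ℝ 2 P}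
    (h : IsInvertible P m ε D) (he : ∀ t, e t =ᵐ[P] ε t) (hy : ∀ t, y t =ᵐ[P] fun ω => D t ω - m)
    (t : ℤ) : e t ∈ linearPast y t := by
  refine EMetric.mem_closure_iff.2 fun δ hδ => ?_
  obtain ⟨K, c, hK⟩ := h t δ hδ
  refine ⟨∑ k ∈ Finset.range K, c k • y (t - k), Submodule.sum_mem _ fun k _ =>
    Submodule.smul_mem _ _ (Submodule.subset_span ⟨t - k, by simp, rfl⟩), ?_⟩
  rw [Lp.edist_def]
  refine (eLpNorm_congr_ae ?_).trans_lt hK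
  filter_upwards [he t, coeFn_sum_range_smul hy c K t] with ω h h'
  rw [Pi.sub_apply, h, h']

end Lp

/-! ### The odd policy -/

lemma IsMinimumPhase.const_mul {r : Fin 3 → ℝ} (hr : IsMinimumPhase r) {b : ℝ} (hb : b ≠ 0) :
    IsMinimumPhase fun i => b * r i := by
  refine fun a hC h => hr a hC fun k => ?_
  have := h k
  rw [mul_assoc, mul_assoc, mul_assoc, ← mul_add, ← mul_add] at this
  exact (mul_eq_zero.1 this).resolve_left hb

/-- All roots of a relative transfer function lie inside the unit disc; reversing its coefficients
yields a minimum phase polynomial of equal modulus on the unit circle and constant coefficient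
`± α`. -/
lemma exists_isMinimumPhase_oddTransfer {α : ℝ} (hα : 1 < α) (n : ℕ) :
    ∃ c r : Fin 3 → ℝ, oddTransfer α n = quadSeries c ∧ IsMinimumPhase r ∧ |r 0| = α ∧
      c 0 ^ 2 + c 1 ^ 2 + c 2 ^ 2 = r 0 ^ 2 + r 1 ^ 2 + r 2 ^ 2 ∧
      c 0 * c 1 + c 1 * c 2 = r 0 * r 1 + r 1 * r 2 ∧ c 0 * c 2 = r 0 * r 2 := by
  have hα0 : 0 < α := zero_lt_one.trans hα
  unfold oddTransfer
  split_ifs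
  · refine ⟨![1, α, α], ![α, α, 1], ?_, isMinimumPhase_quadratic hα, abs_of_pos hα0, ?_, ?_, ?_⟩
    · simp [quadSeries]
    all_goals simp only [Matrix.cons_val]; ring
  · refine ⟨![1, 0, -α], ![-α, 0, 1], ?_, isMinimumPhase_even hα, ?_, ?_, ?_, ?_⟩
    · simp [quadSeries, sub_eq_add_neg]
    · simp [abs_of_pos hα0]
    all_goals simp only [Matrix.cons_val]; ring
  · have habs : |(-1) ^ n * α| = α := by
      rw [abs_mul, abs_neg_one_pow, one_mul, abs_of_pos hα0]
    refine ⟨![1, (-1) ^ n * α, 0], ![(-1) ^ n * α, 1, 0], ?_,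
      isMinimumPhase_linear (by rwa [habs]), habs, ?_, ?_, ?_⟩
    · simp [quadSeries]
    all_goals simp only [Matrix.cons_val]; ring

/-- The terms in `z²` of the first two sellers cancel, the remaining `a z` is offset by the third
seller, and the later sellers cancel in consecutive pairs. -/
lemma sum_oddTransfer (a : ℝ) (k : ℕ) :
    ∑ i ∈ Finset.range (2 * k + 3), oddTransfer a (i + 1) =
      PowerSeries.C ((2 * k + 3 : ℕ) : ℝ) := by
  induction k with
  | zero =>
    have h3 : (PowerSeries.C (3 : ℝ)) = 3 := map_ofNat _ 3
    simp [Finset.sum_range_succ, oddTransfer, h3]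
    ring
  | succ k ih =>
    have h1 : ∀ j, 3 ≤ j → oddTransfer a j =
        1 + PowerSeries.C ((-1) ^ j * a) * PowerSeries.X := fun j hj => by
      rw [oddTransfer, if_neg (by omega), if_neg (by omega)]
    rw [show 2 * (k + 1) + 3 = 2 * k + 3 + 1 + 1 by ring, Finset.sum_range_succ,
      Finset.sum_range_succ, ih, h1 _ (by omega), h1 _ (by omega), pow_succ (-1 : ℝ) (2 * k + 3 + 1)]
    push_cast
    simp only [map_add, map_mul, map_neg, map_one]
    ring

lemma isAdmissible_oddPolicy {N : ℕ} (hN3 : 3 ≤ N) (hNodd : Odd N) (m : ℝ) {α : ℝ} (hα : 1 < α) :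
    (oddPolicy N m α).IsAdmissible m := by
  have hN0 : (N : ℝ) ≠ 0 := by positivity
  refine ⟨fun n => ?_, ?_, ?_⟩
  · obtain ⟨c, -, hc, -⟩ := exists_isMinimumPhase_oddTransfer hα (n + 1)
    simp only [oddPolicy, hc, IsSquareSummable, PowerSeries.coeff_C_mul, mul_pow]
    exact (isSquareSummable_quadSeries c).mul_left _
  · simp only [oddPolicy, Finset.sum_const, Finset.card_univ, Fintype.card_fin, nsmul_eq_mul]
    field_simp
  · obtain ⟨k, rfl⟩ : ∃ k, N = 2 * k + 3 := by
      obtain ⟨j, rfl⟩ := hNodd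
      exact ⟨j - 1, by omega⟩
    simp only [oddPolicy]
    rw [← Finset.mul_sum, Fin.sum_univ_eq_sum_range fun i => oddTransfer α (i + 1),
      sum_oddTransfer, ← map_mul, one_div_mul_cancel hN0, map_one]

/-! ### Demand processes of the sellers -/

section MarketDemand

variable {P : Measure Ω} {m : ℝ} {ψ : PowerSeries ℝ} {ε D : ℤ → Ω → ℝ}

lemma IsMarketDemand.memLp_shock (hD : IsMarketDemand P m ψ ε D) (t : ℤ) : MemLp (ε t) 2 P :=
  (hD.whiteNoise.gaussian.hasGaussianLaw_eval t).memLp_two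

lemma IsMarketDemand.memLp_demand (hD : IsMarketDemand P m ψ ε D) (t : ℤ) :
    MemLp (fun ω => D t ω - m) 2 P :=
  hD.representation.memLp hD.memLp_shock
    (fun s => ((hD.measurable s).sub_const m).aestronglyMeasurable) t

/-- The shocks as elements of `L²(P)`. -/
def IsMarketDemand.shock (hD : IsMarketDemand P m ψ ε D) (t : ℤ) : Lp ℝ 2 P :=
  (hD.memLp_shock t).toLp

/-- The centred market demand as elements of `L²(P)`. -/
def IsMarketDemand.demand (hD : IsMarketDemand P m ψ ε D) (t : ℤ) : Lp ℝ 2 P :=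
  (hD.memLp_demand t).toLp

lemma IsMarketDemand.coeFn_shock (hD : IsMarketDemand P m ψ ε D) (t : ℤ) :
    hD.shock t =ᵐ[P] ε t := (hD.memLp_shock t).coeFn_toLp

lemma IsMarketDemand.coeFn_demand (hD : IsMarketDemand P m ψ ε D) (t : ℤ) :
    hD.demand t =ᵐ[P] fun ω => D t ω - m := (hD.memLp_demand t).coeFn_toLp

lemma IsMarketDemand.isMovingAverage (hD : IsMarketDemand P m ψ ε D) :
    IsMovingAverage ψ hD.shock hD.demand :=
  (isFilterOutput_iff hD.coeFn_shock hD.coeFn_demand).1 hD.representation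

variable {N : ℕ} {π : Policy N} {n : Fin N} {c : Fin 3 → ℝ}

lemma exists_isSellerDemand (hD : IsMarketDemand P m ψ ε D) (hc : π.transfer n = quadSeries c) :
    ∃ X, π.IsSellerDemand P m D n X := by
  let y : ℤ → Ω → ℝ := fun t ω => D t ω - m
  have hy : ∀ t, Measurable (y t) := fun t => (hD.measurable t).sub_const m
  refine ⟨fun t ω => π.mean n + (c 0 * y t ω + c 1 * y (t - 1) ω + c 2 * y (t - 2) ω),
    fun t => ?_, ?_⟩
  · exact measurable_const.add ((((hy t).const_mul _).add ((hy _).const_mul _)).add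
      ((hy _).const_mul _))
  · rw [hc]
    refine (isFilterOutput_iff hD.coeFn_demand fun t => ?_).2
      (isMovingAverage_quadSeries_iff.2 rfl)
    rw [quadFilter]
    filter_upwards [Lp.coeFn_add (c 0 • hD.demand t + c 1 • hD.demand (t - 1))
        (c 2 • hD.demand (t - 2)), Lp.coeFn_add (c 0 • hD.demand t) (c 1 • hD.demand (t - 1)),
      Lp.coeFn_smul (c 0) (hD.demand t), Lp.coeFn_smul (c 1) (hD.demand (t - 1)),
      Lp.coeFn_smul (c 2) (hD.demand (t - 2)), hD.coeFn_demand t, hD.coeFn_demand (t - 1),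
      hD.coeFn_demand (t - 2)] with ω h1 h2 h3 h4 h5 h6 h7 h8
    simp only [h1, h2, h3, h4, h5, h6, h7, h8, Pi.add_apply, Pi.smul_apply, smul_eq_mul, y]
    ring

lemma Policy.IsSellerDemand.quadFilter_ae_eq (hD : IsMarketDemand P m ψ ε D)
    (hc : π.transfer n = quadSeries c) {X : ℤ → Ω → ℝ} (hX : π.IsSellerDemand P m D n X) (t : ℤ) :
    ⇑(quadFilter c hD.demand t) =ᵐ[P] fun ω => X t ω - π.mean n := by
  have hL2 := hX.filter.memLp hD.memLp_demand
    fun s => ((hX.measurable s).sub_const _).aestronglyMeasurable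
  have hx := (isFilterOutput_iff hD.coeFn_demand fun s => (hL2 s).coeFn_toLp).1 hX.filter
  rw [hc, isMovingAverage_quadSeries_iff] at hx
  rw [← hx]
  exact (hL2 t).coeFn_toLp

lemma Policy.IsSellerDemand.isFilterOutput (hD : IsMarketDemand P m ψ ε D)
    (hc : π.transfer n = quadSeries c) {X : ℤ → Ω → ℝ} (hX : π.IsSellerDemand P m D n X) :
    IsFilterOutput P (π.transfer n * ψ) ε fun t ω => X t ω - π.mean n := by
  rw [hc]
  exact (isFilterOutput_iff hD.coeFn_shock (hX.quadFilter_ae_eq hD hc)).2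
    (hD.isMovingAverage.quadFilter c)

variable [IsProbabilityMeasure P]

lemma IsMarketDemand.constantCoeff_ne_zero (hD : IsMarketDemand P m ψ ε D) :
    PowerSeries.constantCoeff ψ ≠ 0 :=
  hD.isMovingAverage.constantCoeff_ne_zero (hD.whiteNoise.orthonormal hD.coeFn_shock)
    (hD.invertible.mem_linearPast hD.coeFn_shock hD.coeFn_demand)

/-- A seller whose transfer function is the quadratic `c` has as root MSFE the size of the newest
shock's contribution to `r(B) (D - m)`, where `r` is the minimum phase polynomial with the
autocorrelation of `c`. -/
lemma sellerHasRootMSFE (hD : IsMarketDemand P m ψ ε D) (hc : π.transfer n = quadSeries c)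
    {r : Fin 3 → ℝ} (hr : IsMinimumPhase r)
    (h0 : c 0 ^ 2 + c 1 ^ 2 + c 2 ^ 2 = r 0 ^ 2 + r 1 ^ 2 + r 2 ^ 2)
    (h1 : c 0 * c 1 + c 1 * c 2 = r 0 * r 1 + r 1 * r 2) (h2 : c 0 * c 2 = r 0 * r 2) :
    π.SellerHasRootMSFE P m D n |r 0 * PowerSeries.constantCoeff ψ| := by
  refine ⟨exists_isSellerDemand hD hc, fun X hX => ?_⟩
  refine hasRootMSFE_of_isInnovation hD.whiteNoise hD.coeFn_shock hX.measurable
    (fun t => ?_) (hX.quadFilter_ae_eq hD hc) (abs_nonneg _) fun t =>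
      hD.isMovingAverage.exists_isInnovation_norm_eq (hD.whiteNoise.orthonormal hD.coeFn_shock)
        (hD.invertible.mem_linearPast hD.coeFn_shock hD.coeFn_demand) hr h0 h1 h2 t
  exact quadFilter_mem fun s _ =>
    linearPast_le_gaussianSpan hD.shock s (hD.isMovingAverage.mem_linearPast s)

end MarketDemand

end DemandAllocation

end

theorem proposition4 {Ω : Type*} [MeasurableSpace Ω] (P : Measure Ω) [IsProbabilityMeasure P]
    (m : ℝ) (ψ : PowerSeries ℝ) (ε D : ℤ → Ω → ℝ) (hD : IsMarketDemand P m ψ ε D)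
    (N : ℕ) (hN3 : 3 ≤ N) (hNodd : Odd N) (σ : ℝ) (hσ : sigmaL N ψ < σ) :
    (oddPolicy N m (σ / sigmaL N ψ)).IsAdmissible m ∧
    (oddPolicy N m (σ / sigmaL N ψ)).IsNeutral P m D ∧
    ∀ n : Fin N,
      (oddPolicy N m (σ / sigmaL N ψ)).SellerHasRootMSFE P m D n σ ∧
      ∀ X, (oddPolicy N m (σ / sigmaL N ψ)).IsSellerDemand P m D n X →
        IsFilterOutput P
          (PowerSeries.C (1 / (N : ℝ)) * ψ * oddTransfer (σ / sigmaL N ψ) (n + 1))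
          ε (fun t ω => X t ω - m / N) := by
  have hN0 : (0 : ℝ) < N := by positivity
  have hψ0 : 0 < |PowerSeries.constantCoeff ψ| := abs_pos.2 hD.constantCoeff_ne_zero
  have hL : 0 < sigmaL N ψ := div_pos hψ0 hN0
  have hα : 1 < σ / sigmaL N ψ := (one_lt_div hL).2 hσ
  set α := σ / sigmaL N ψ with hαdef
  have hseries : ∀ n : Fin N, ∃ c r : Fin 3 → ℝ, (oddPolicy N m α).transfer n = quadSeries c ∧
      IsMinimumPhase r ∧ |r 0 * PowerSeries.constantCoeff ψ| = σ ∧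
      c 0 ^ 2 + c 1 ^ 2 + c 2 ^ 2 = r 0 ^ 2 + r 1 ^ 2 + r 2 ^ 2 ∧
      c 0 * c 1 + c 1 * c 2 = r 0 * r 1 + r 1 * r 2 ∧ c 0 * c 2 = r 0 * r 2 := fun n => by
    obtain ⟨c, r, hc, hr, hr0, h0, h1, h2⟩ := exists_isMinimumPhase_oddTransfer hα (n + 1)
    refine ⟨fun i => 1 / N * c i, fun i => 1 / N * r i, ?_, hr.const_mul (by positivity), ?_, ?_,
      ?_, ?_⟩
    · simp only [oddPolicy, hc, quadSeries, map_mul]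
      ring
    · rw [abs_mul, abs_mul, hr0, abs_of_pos (by positivity), hαdef, sigmaL]
      field_simp
    · linear_combination (1 / (N : ℝ)) ^ 2 * h0
    · linear_combination (1 / (N : ℝ)) ^ 2 * h1
    · linear_combination (1 / (N : ℝ)) ^ 2 * h2
  have hMSFE : ∀ n, (oddPolicy N m α).SellerHasRootMSFE P m D n σ := fun n => by
    obtain ⟨c, r, hc, hr, hr0, h0, h1, h2⟩ := hseries n
    rw [← hr0]
    exact sellerHasRootMSFE hD hc hr h0 h1 h2
  refine ⟨isAdmissible_oddPolicy hN3 hNodd m hα,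
    ⟨σ, hL.trans hσ, fun n => ⟨rfl, hMSFE n⟩⟩, fun n => ⟨hMSFE n, fun X hX => ?_⟩⟩
  obtain ⟨c, -, hc, -⟩ := hseries n
  have h := hX.isFilterOutput hD hc
  rwa [oddPolicy, mul_right_comm] at h
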